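/- Notation. For integers $n,k\ge 1$ let $\mu$ be a probability distribution on $\binom{[n]}{k}$, the $k$-element subsets of $[n]=\{1,\dots,n\}$. Let $\mu D_{k\to 1}$ be the distribution on $[n]$ of a uniformly random element of a random set $S\sim\mu$. For $\alpha\in(0,1]$, $\mu$ is called $(1/\alpha)$-entropically independent if for every probability distribution $\nu$ on $\binom{[n]}{k}$ $$\mathcal D_{\mathrm{KL}}(\nu D_{k\to1}\,\|\,\mu D_{k\to1})\le \frac1{\alpha k}\,\mathcal D_{\mathrm{KL}}(\nu\,\|\,\mu).$$ For $\lambda\in\mathbb R_{\ge0}^n$ the external field $\lambda\star\mu$ is the distribution on $\binom{[n]}{k}$ with $(\lambda\star\mu)(S)\propto\mu(S)\prod_{i\in S}\lambda_i$; if all these weights are $0$, an attempt to sample from $\lambda\star\mu$ yields a failure symbol $\bot$. An algorithm is a program for a randomized real register machine, with registers for real numbers and for elements of $[n]$, in which each of the following costs one step: loading a rational constant; $+,-,\times,\div$ and powers $x^y$ on reals; a conditional jump comparing two reals; drawing a fair random bit; drawing a uniformly random element of $[n]$; reading the estimate $p_i$ of a given $i\in[n]$; drawing a fresh independent sample from the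 sampling oracle; appending a pair $(i,w)\in[n]\times\mathbb R$ to the output. The output represents the vector $\lambda\in\mathbb R^n$ for which $\lambda_i$ is the sum of all $w$ over the output pairs $(i,w)$. Theorem. There are one program and universal constants $A,d\in\mathbb N$ such that the following holds for all $n,k\ge1$, all $\alpha\in(0,1]$, $c>0$, $\varepsilon\in(0,1)$, and every $(1/\alpha)$-entropically independent probability distribution $\mu$ on $\binom{[n]}{k}$. Suppose that the estimates $p_1,\dots,p_n\in\mathbb R$ satisfy $p_1+\dots+p_n=k$ and $$p_i\ \ge\ c\cdot\mathbb P_{S\sim\mu}[i\in S]\qquad\text{for all } i\in[n],$$ and that the sampling oracle returns i.i.d. samples $i\in[n]$ with probabilities $p_i/k$. Then on input $(n,k,\alpha,c,\varepsilon)$, with $\mu$ accessible only through the estimates and the oracle, the program always halts within $$A\left(\frac{k}{c\,\varepsilon}\right)^{d} n^{1-\alpha}$$ steps, and outputs a random vector $\lambda\in\mathbb R_{\ge0}^n$ with at most $A\left(\frac{k}{c\,\varepsilon}\right)^{d} n^{1-\alpha}$ nonzero entries such that the outcome of drawing $\lambda$ and then a sample of $\lambda\star\mu$ has total variation distance at most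 $\varepsilon$ from $\mu$ (a failure $\bot$ being an outcome outside the support of $\mu$). In particular, for constant $c$ and $\varepsilon$ the time and the sparsity are $n^{1-\alpha}\cdot\mathrm{poly}(k)$. -/

import Mathlib

open scoped ENNReal

noncomputable section

namespace DomainSparsification

/-! ### Distributions on `k`-subsets of `[n]` -/

/-- The family of `k`-element subsets of `[n]`. -/
abbrev KSubset (n k : ℕ) : Type := {S : Finset (Fin n) // S.card = k}

theorem KSubset.nonempty {n k : ℕ} [NeZero k] (S : KSubset n k) : S.1.Nonempty :=
  Finset.card_pos.1 (S.2.symm ▸ Nat.pos_of_ne_zero (NeZero.ne k) : 0 < S.1.card)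

/-- The marginal probability that `i` belongs to a random set `S` drawn from `μ`. -/
def marginal {n k : ℕ} (μ : PMF (KSubset n k)) (i : Fin n) : ℝ :=
  ∑ S : KSubset n k, if i ∈ S.1 then (μ S).toReal else 0

/-- The distribution obtained from `μ` by the down operator from `k`-sets to singletons (which are
identified with elements): draw `S` from `μ`, then a uniformly random element of `S`. -/
def down {n k : ℕ} [NeZero k] (μ : PMF (KSubset n k)) : PMF (Fin n) :=
  μ.bind fun S => PMF.uniformOfFinset S.1 S.nonempty

/-- Kullback–Leibler divergence of discrete distributions. -/
def kl {Ω : Type*} (ν μ : PMF Ω) : ℝ≥0∞ :=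
  letI : MeasurableSpace Ω := ⊤
  InformationTheory.klDiv ν.toMeasure μ.toMeasure

/-- `μ` is `(1/α)`-entropically independent. -/
def EntropicallyIndependent {n k : ℕ} [NeZero k] (α : ℝ) (μ : PMF (KSubset n k)) : Prop :=
  ∀ ν : PMF (KSubset n k), kl (down ν) (down μ) ≤ ENNReal.ofReal (1 / (α * k)) * kl ν μ

/-- Total variation distance. -/
def tvDist {Ω : Type*} [Fintype Ω] (μ ν : PMF Ω) : ℝ :=
  (1 / 2) * ∑ ω, |(μ ω).toReal - (ν ω).toReal|

/-- The weight `μ(S) ∏_{i ∈ S} λ_i`, for a nonnegative vector `lam`. -/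
def fieldWeight {n k : ℕ} (lam : Fin n → ℝ) (μ : PMF (KSubset n k)) (S : KSubset n k) : ℝ≥0∞ :=
  μ S * ∏ i ∈ S.1, ENNReal.ofReal (lam i)

theorem tsum_fieldWeight_ne_top {n k : ℕ} (lam : Fin n → ℝ) (μ : PMF (KSubset n k)) :
    ∑' S, fieldWeight lam μ S ≠ ∞ := by
  rw [tsum_fintype]
  refine (ENNReal.sum_lt_top.2 fun S _ => ?_).ne
  exact ENNReal.mul_lt_top (μ.apply_lt_top S) (ENNReal.prod_lt_top fun _ _ => ENNReal.ofReal_lt_top)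

open Classical in
/-- The external field `λ ⋆ μ`, as the law of the outcome of an attempt to sample from it.
If all weights vanish, then `λ ⋆ μ` is not defined and the attempt fails, with outcome `none`. -/
def extField {n k : ℕ} (lam : Fin n → ℝ) (μ : PMF (KSubset n k)) : PMF (Option (KSubset n k)) :=
  if h : ∑' S, fieldWeight lam μ S = 0 then PMF.pure none
  else (PMF.normalize (fieldWeight lam μ) h (tsum_fieldWeight_ne_top lam μ)).map some

/-! ### Randomized real register machines with oracles

A machine has real registers, registers holding elements of `[n]`, and an output list. Every
instruction, including a call of an oracle, costs one step. -/

/-- Instructions. Arguments `a b c` are numbers of real registers, `j` of an index register. -/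
inductive Instr : Type
  /-- `reg a := q` -/
  | const (a : ℕ) (q : ℚ)
  /-- `reg a := reg b + reg c` -/
  | add (a b c : ℕ)
  /-- `reg a := reg b - reg c` -/
  | sub (a b c : ℕ)
  /-- `reg a := reg b * reg c` -/
  | mul (a b c : ℕ)
  /-- `reg a := reg b / reg c` -/
  | div (a b c : ℕ)
  /-- `reg a := reg b ^ reg c` -/
  | pow (a b c : ℕ)
  /-- if `reg a < reg b`, go to instruction number `l` -/
  | jumpLT (a b l : ℕ)
  /-- `reg a` := a fair random bit -/
  | coin (a : ℕ)
  /-- `idx j` := a uniformly random element of `[n]` -/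
  | uniform (j : ℕ)
  /-- `idx j` := a fresh sample from the sampling oracle -/
  | sample (j : ℕ)
  /-- `reg a` := the marginal estimate of the element `idx j` -/
  | estimate (a j : ℕ)
  /-- append the pair `(idx j, reg a)` to the output -/
  | emit (j a : ℕ)

/-- A program; its instructions are numbered from `0`. -/
abbrev Program : Type := List Instr

/-- A configuration of a machine. -/
structure Config (n : ℕ) : Type where
  /-- number of the next instruction -/
  pc : ℕ
  /-- real registers -/
  reg : ℕ → ℝ
  /-- index registers -/
  idx : ℕ → Fin n
  /-- output so far -/
  out : List (Fin n × ℝ)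

namespace Config

variable {n : ℕ}

/-- Write `x` to a real register and go to the next instruction. -/
def setReg (s : Config n) (a : ℕ) (x : ℝ) : Config n :=
  { s with pc := s.pc + 1, reg := Function.update s.reg a x }

/-- Write `i` to an index register and go to the next instruction. -/
def setIdx (s : Config n) (j : ℕ) (i : Fin n) : Config n :=
  { s with pc := s.pc + 1, idx := Function.update s.idx j i }

/-- The vector with sparse representation `s.out`: entries with the same index are added up. -/
def field (s : Config n) (i : Fin n) : ℝ :=
  (s.out.map fun e => if e.1 = i then e.2 else 0).sum

end Config

/-- Law of the configuration after one instruction, with marginal estimates `p` and a sampling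
oracle whose answers have law `D`, each answer independent of everything before. -/
def exec {n : ℕ} [NeZero n] (p : Fin n → ℝ) (D : PMF (Fin n)) (s : Config n) :
    Instr → PMF (Config n)
  | .const a q => PMF.pure (s.setReg a q)
  | .add a b c => PMF.pure (s.setReg a (s.reg b + s.reg c))
  | .sub a b c => PMF.pure (s.setReg a (s.reg b - s.reg c))
  | .mul a b c => PMF.pure (s.setReg a (s.reg b * s.reg c))
  | .div a b c => PMF.pure (s.setReg a (s.reg b / s.reg c))
  | .pow a b c => PMF.pure (s.setReg a (s.reg b ^ s.reg c))
  | .jumpLT a b l => PMF.pure { s with pc := if s.reg a < s.reg b then l else s.pc + 1 }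
  | .coin a => (PMF.uniformOfFintype Bool).map fun b => s.setReg a (if b then 1 else 0)
  | .uniform j => (PMF.uniformOfFintype (Fin n)).map fun i => s.setIdx j i
  | .sample j => D.map fun i => s.setIdx j i
  | .estimate a j => PMF.pure (s.setReg a (p (s.idx j)))
  | .emit j a => PMF.pure { s with pc := s.pc + 1, out := s.out ++ [(s.idx j, s.reg a)] }

/-- The machine has halted: there is no next instruction. -/
def Halted {n : ℕ} (P : Program) (s : Config n) : Prop := P.length ≤ s.pc

/-- One step of a machine; a halted machine stays where it is. -/
def step {n : ℕ} [NeZero n] (P : Program) (p : Fin n → ℝ) (D : PMF (Fin n)) (s : Config n) :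
    PMF (Config n) :=
  match P[s.pc]? with
  | none => PMF.pure s
  | some ins => exec p D s ins

/-- Law of the configuration after `m` steps from `s`. -/
def run {n : ℕ} [NeZero n] (P : Program) (p : Fin n → ℝ) (D : PMF (Fin n)) :
    ℕ → Config n → PMF (Config n)
  | 0, s => PMF.pure s
  | m + 1, s => (step P p D s).bind (run P p D m)

/-- The initial configuration: the numbers in `input` are in the first real registers, all other
registers hold zero, and the output is empty. -/
def init (n : ℕ) [NeZero n] (input : List ℝ) : Config n where
  pc := 0
  reg := fun a => input.getD a 0
  idx := fun _ => 0
  out := []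

end DomainSparsification

end

/-!
The program draws `t ≈ 16 k² n^(1-α) / (c ε²)` elements independently, each from the mixture
`q i = (p i / k + 1 / n) / 2` of the sampling oracle and the uniform distribution, and outputs
`lam i = N i / (2 q i)`, where `N i` is the number of times that `i` is drawn.

*Unbiasedness.* The joint factorial moments of the multinomial vector `N` are explicit
(`drawExp_prod_descFactorial`), so `∏ i ∈ S, lam i` has the same mean for all `k`-sets `S`. Hence if
the normalizing constant `Z` of `lam ⋆ μ` were equal to its mean `m`, then the sample would have law
`μ`. In general its distance from `μ` is at most `𝔼 |Z / m - 1| / 2` (`tvDist_map_some_le`; a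
failure occurs exactly when `Z = 0`), and it suffices that `𝔼 Z² ≤ (1 + ε²) m²`.

*Second moment.* Up to the ratio of `t ^ k` to the falling factorial, which is close to `1` as
`k² ≤ ε² t / 16`, the factorial moments bound `𝔼 Z² / m²` by the mean of
`∏ i ∈ S ∩ T, (1 + 1 / (t q i))` over independent `S, T ∼ μ`
(`drawExp_prod_count_mul_prod_count_le`). For fixed `T` its mean over `S` is the sum over `U ⊆ T` of
`ℙ[U ⊆ S] * ∏ i ∈ U, 1 / (t q i)`. This is at most `(1 + x) ^ k` if each term is at most `x ^ |U|`
(`sum_mul_prod_inter_le`), and `x = 6 k n^(1-α) / (c t)` will do.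

*Entropic independence.* That bound on the terms comes from comparing `μ` with its conditioning `ν`
on `U ⊆ S`: the divergence of `ν` from `μ` is `log (1 / ℙ[U ⊆ S])`, and that of the projections to
`[n]` is at least `(1 / k) ∑ i ∈ U, (log (1 / m i) - 1)`, where `m i` are the marginals of `μ`. So
`ℙ[U ⊆ S] ≤ ∏ i ∈ U, e * m i ^ α` (`jointMarginal_le_prod`). Finally
`m i ^ α / q i ≤ 2 (k / c) n^(1-α)`, since `q i` is bounded below both in terms of `c m i / k` and
in terms of `1 / n` (`marginal_rpow_le`).
-/

noncomputable section

namespace DomainSparsification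

variable {n k : ℕ}

/-! ### Entropic independence bounds joint marginals -/

/-- The Kullback–Leibler divergence on a finite set as the usual sum. A term with `ν ω = 0` is zero,
also where `μ ω = 0`. -/
theorem kl_eq_ofReal_sum {Ω : Type*} [Fintype Ω] (ν μ : PMF Ω) (h : ∀ ω, μ ω = 0 → ν ω = 0) :
    kl ν μ = ENNReal.ofReal
      (∑ ω, (ν ω).toReal * Real.log ((ν ω).toReal / (μ ω).toReal)) := by
  let _ : MeasurableSpace Ω := ⊤
  have _ : DiscreteMeasurableSpace Ω := ⟨fun _ => trivial⟩
  have hac : MeasureTheory.Measure.AbsolutelyContinuous ν.toMeasure μ.toMeasure := by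
    intro s hs
    rw [PMF.toMeasure_apply_eq_zero_iff _ (MeasurableSet.of_discrete)] at hs ⊢
    rw [Set.disjoint_left] at hs ⊢
    intro ω hω
    exact hs fun h0 => hω (h ω h0)
  have hint : MeasureTheory.Integrable (MeasureTheory.llr ν.toMeasure μ.toMeasure) ν.toMeasure :=
    MeasureTheory.Integrable.of_finite
  have hd : ∀ ω, (ν.toMeasure.rnDeriv μ.toMeasure ω) * μ ω = ν ω := by
    intro ω
    have h1 := MeasureTheory.Measure.withDensity_rnDeriv_eq _ _ hac
    have h2 := congrArg (fun m => m {ω}) h1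
    rw [MeasureTheory.withDensity_apply _ (MeasurableSet.of_discrete),
      MeasureTheory.lintegral_singleton,
      PMF.toMeasure_apply_singleton _ _ (MeasurableSet.of_discrete),
      PMF.toMeasure_apply_singleton _ _ (MeasurableSet.of_discrete)] at h2
    exact h2
  change InformationTheory.klDiv ν.toMeasure μ.toMeasure = _
  rw [← ENNReal.ofReal_toReal (InformationTheory.klDiv_ne_top hac hint),
    InformationTheory.toReal_klDiv_of_measure_eq hac (by simp), PMF.integral_eq_sum]
  congr 1
  refine Finset.sum_congr rfl fun ω _ => ?_
  by_cases h0 : ν ω = 0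
  · simp [h0]
  have hμ : (μ ω).toReal ≠ 0 :=
    (ENNReal.toReal_pos (fun h1 => h0 (h ω h1)) (μ.apply_ne_top ω)).ne'
  rw [smul_eq_mul, MeasureTheory.llr_def]
  refine congrArg (fun x => (ν ω).toReal * Real.log x) ?_
  rw [eq_div_iff hμ, ← ENNReal.toReal_mul, hd]

/-- The probability that a random set drawn from `μ` contains `U`. -/
def jointMarginal (μ : PMF (KSubset n k)) (U : Finset (Fin n)) : ℝ :=
  ∑ S : KSubset n k, if U ⊆ S.1 then (μ S).toReal else 0

theorem sum_toReal_eq_one {Ω : Type*} [Fintype Ω] (μ : PMF Ω) : ∑ ω, (μ ω).toReal = 1 := by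
  rw [← ENNReal.toReal_sum fun ω _ => μ.apply_ne_top ω, ← tsum_fintype (L := .unconditional _),
    μ.tsum_coe]
  rfl

theorem down_apply_toReal [NeZero k] (μ : PMF (KSubset n k)) (i : Fin n) :
    (down μ i).toReal = marginal μ i / k := by
  rw [down, PMF.bind_apply, tsum_fintype, ENNReal.toReal_sum, marginal, Finset.sum_div]
  · refine Finset.sum_congr rfl fun S _ => ?_
    rw [ENNReal.toReal_mul, PMF.uniformOfFinset_apply, S.2]
    split_ifs <;> simp [div_eq_mul_inv]
  · intro S _
    exact ENNReal.mul_ne_top (PMF.apply_ne_top _ _) (PMF.apply_ne_top _ _)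

theorem marginal_nonneg (μ : PMF (KSubset n k)) (i : Fin n) : 0 ≤ marginal μ i :=
  Finset.sum_nonneg fun S _ => by split_ifs <;> positivity

theorem jointMarginal_nonneg (μ : PMF (KSubset n k)) (U : Finset (Fin n)) :
    0 ≤ jointMarginal μ U :=
  Finset.sum_nonneg fun S _ => by split_ifs <;> positivity

theorem jointMarginal_le_one (μ : PMF (KSubset n k)) (U : Finset (Fin n)) :
    jointMarginal μ U ≤ 1 := by
  rw [← sum_toReal_eq_one μ]
  exact Finset.sum_le_sum fun S _ => by split_ifs <;> simp

theorem jointMarginal_le_marginal (μ : PMF (KSubset n k)) {U : Finset (Fin n)} {i : Fin n}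
    (hi : i ∈ U) : jointMarginal μ U ≤ marginal μ i := by
  refine Finset.sum_le_sum fun S _ => ?_
  by_cases h : U ⊆ S.1
  · simp [h, h hi]
  · rw [if_neg h]; split_ifs <;> positivity

theorem sum_marginal (μ : PMF (KSubset n k)) : ∑ i, marginal μ i = k := by
  simp only [marginal]
  rw [Finset.sum_comm]
  have : ∀ S : KSubset n k, ∑ i, (if i ∈ S.1 then (μ S).toReal else 0) = k * (μ S).toReal := by
    intro S
    rw [← Finset.sum_filter, Finset.filter_mem_eq_inter, Finset.univ_inter, Finset.sum_const, S.2,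
      nsmul_eq_mul]
  simp only [this]
  rw [← Finset.mul_sum, sum_toReal_eq_one, mul_one]

theorem sub_le_mul_log_div {x y : ℝ} (hx : 0 ≤ x) (hy : 0 ≤ y) (h : y = 0 → x = 0) :
    x - y ≤ x * Real.log (x / y) := by
  rcases hx.eq_or_lt with rfl | hx
  · simpa using hy
  have hy' : 0 < y := hy.lt_of_ne fun h0 => hx.ne' (h h0.symm)
  have := Real.one_sub_inv_le_log_of_pos (div_pos hx hy')
  calc x - y = x * (1 - (x / y)⁻¹) := by field_simp
    _ ≤ _ := mul_le_mul_of_nonneg_left this hx.le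

/-- Entropic independence, applied to `μ` conditioned on `U ⊆ S`, bounds the probability of
`U ⊆ S` by the marginals of the elements of `U`. -/
theorem jointMarginal_le_prod [NeZero k] {α : ℝ} (hα : 0 < α) (hα1 : α ≤ 1)
    {μ : PMF (KSubset n k)} (hμ : EntropicallyIndependent α μ) (U : Finset (Fin n)) :
    jointMarginal μ U ≤ ∏ i ∈ U, (Real.exp 1 * marginal μ i ^ α) := by
  set P := jointMarginal μ U with hP
  have hk : (0 : ℝ) < k := Nat.cast_pos.2 (Nat.pos_of_ne_zero (NeZero.ne k))
  rcases (jointMarginal_nonneg μ U).eq_or_lt with h0 | hpos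
  · rw [hP, ← h0]
    exact Finset.prod_nonneg fun i _ =>
      mul_nonneg (Real.exp_pos _).le (Real.rpow_nonneg (marginal_nonneg μ i) _)
  rw [← hP] at hpos
  have hm : ∀ i ∈ U, 0 < marginal μ i := fun i hi =>
    hpos.trans_le (jointMarginal_le_marginal μ hi)
  -- The test distribution is `μ` conditioned on `U ⊆ S`.
  have hex : ∃ S ∈ {S : KSubset n k | U ⊆ S.1}, S ∈ μ.support := by
    by_contra! hcon
    refine hpos.ne' (Finset.sum_eq_zero fun S _ => ?_)
    split_ifs with h
    · have := hcon S h
      rw [PMF.mem_support_iff, not_not] at this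
      simp [this]
    · rfl
  set ν := μ.filter {S : KSubset n k | U ⊆ S.1} hex with hν
  have hνS : ∀ S, (ν S).toReal = if U ⊆ S.1 then (μ S).toReal / P else 0 := by
    intro S
    have hsum : (∑' S', Set.indicator {S : KSubset n k | U ⊆ S.1} μ S').toReal = P := by
      rw [tsum_fintype, ENNReal.toReal_sum]
      · refine Finset.sum_congr rfl fun S _ => ?_
        by_cases h : U ⊆ S.1 <;> simp [Set.indicator, h]
      · intro S _
        by_cases h : U ⊆ S.1 <;> simp [Set.indicator, h, μ.apply_ne_top]
    rw [hν, PMF.filter_apply, ENNReal.toReal_mul, ENNReal.toReal_inv, hsum]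
    by_cases h : U ⊆ S.1 <;> simp [Set.indicator, h, div_eq_mul_inv]
  have hac : ∀ S, μ S = 0 → ν S = 0 := by
    intro S hS
    have := hνS S
    rw [hS] at this
    have h0 : (ν S).toReal = 0 := by rw [this]; simp
    exact ((ENNReal.toReal_eq_zero_iff _).1 h0).resolve_right (ν.apply_ne_top S)
  have hmν0 : ∀ i, marginal μ i = 0 → marginal ν i = 0 := by
    intro i hi
    unfold marginal at hi ⊢
    rw [Finset.sum_eq_zero_iff_of_nonneg fun S _ => by split_ifs <;> positivity] at hi
    refine Finset.sum_eq_zero fun S hS => ?_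
    have := hi S hS
    split_ifs with h
    · rw [if_pos h] at this
      have h1 := hac S (((ENNReal.toReal_eq_zero_iff _).1 this).resolve_right (μ.apply_ne_top S))
      simp [h1]
    · rfl
  have hacD : ∀ i, down μ i = 0 → down ν i = 0 := by
    intro i hi
    have h1 := down_apply_toReal μ i
    rw [hi, ENNReal.toReal_zero] at h1
    have h2 : marginal μ i = 0 := by
      rcases div_eq_zero_iff.1 h1.symm with h | h
      · exact h
      · exact absurd h hk.ne'
    have h3 := down_apply_toReal ν i
    rw [hmν0 i h2, zero_div] at h3
    exact ((ENNReal.toReal_eq_zero_iff _).1 h3).resolve_right (PMF.apply_ne_top _ _)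
  have hmν1 : ∀ i ∈ U, marginal ν i = 1 := by
    intro i hi
    rw [← sum_toReal_eq_one ν]
    refine Finset.sum_congr rfl fun S _ => ?_
    split_ifs with h
    · rfl
    · rw [hνS, if_neg fun hU => h (hU hi)]
  have hent := hμ ν
  rw [kl_eq_ofReal_sum _ _ hac, kl_eq_ofReal_sum _ _ hacD] at hent
  have hup : ∑ S, (ν S).toReal * Real.log ((ν S).toReal / (μ S).toReal) = - Real.log P := by
    have : ∀ S, (ν S).toReal * Real.log ((ν S).toReal / (μ S).toReal)
        = (ν S).toReal * (- Real.log P) := by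
      intro S
      by_cases h0 : (ν S).toReal = 0
      · simp [h0]
      have h1 := hνS S
      split_ifs at h1 with hU
      · have h2 : (μ S).toReal ≠ 0 := by
          intro h3; rw [h3, zero_div] at h1; exact h0 h1
        congr 1
        rw [h1, ← Real.log_inv]
        congr 1
        field_simp
      · exact absurd h1 h0
    simp only [this]
    rw [← Finset.sum_mul, sum_toReal_eq_one, one_mul]
  have hlow : (1 / k : ℝ) * ∑ i ∈ U, (- Real.log (marginal μ i) - 1) ≤
      ∑ i, (down ν i).toReal * Real.log ((down ν i).toReal / (down μ i).toReal) := by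
    -- Inside `U` the terms are explicit, outside they are at least `x - y`, and the two
    -- distributions have the same total mass.
    have hterm : ∀ i, ((down ν i).toReal - (down μ i).toReal) +
        (if i ∈ U then (1 / k : ℝ) * (- Real.log (marginal μ i) - 1) else 0) ≤
        (down ν i).toReal * Real.log ((down ν i).toReal / (down μ i).toReal) := by
      intro i
      rw [down_apply_toReal, down_apply_toReal]
      split_ifs with hi
      · rw [hmν1 i hi, div_div_div_cancel_right₀ hk.ne', one_div (marginal μ i), Real.log_inv]
        have : 0 ≤ marginal μ i / k := div_nonneg (marginal_nonneg _ _) hk.le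
        linarith
      · rw [add_zero]
        refine sub_le_mul_log_div (div_nonneg (marginal_nonneg _ _) hk.le)
          (div_nonneg (marginal_nonneg _ _) hk.le) fun h => ?_
        rcases div_eq_zero_iff.1 h with h | h
        · rw [hmν0 i h, zero_div]
        · exact absurd h hk.ne'
    have := Finset.sum_le_sum fun i (_ : i ∈ Finset.univ) => hterm i
    rw [Finset.sum_add_distrib, Finset.sum_sub_distrib, sum_toReal_eq_one, sum_toReal_eq_one,
      sub_self, zero_add, ← Finset.sum_filter, Finset.filter_mem_eq_inter, Finset.univ_inter,
      ← Finset.mul_sum] at this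
    exact this
  have hlogP : 0 ≤ - Real.log P := by
    have := Real.log_nonpos hpos.le (jointMarginal_le_one μ U)
    linarith
  rw [hup, ← ENNReal.ofReal_mul (by positivity), ENNReal.ofReal_le_ofReal_iff (by positivity)]
    at hent
  have key : Real.log P ≤ ∑ i ∈ U, (α * Real.log (marginal μ i) + α) := by
    have h1 := hlow.trans hent
    have h2 : 1 / (α * k) * -Real.log P = (1 / k) * (-Real.log P / α) := by field_simp
    rw [h2] at h1
    have h3 := le_of_mul_le_mul_left h1 (by positivity)
    rw [le_div_iff₀ hα] at h3
    have h4 : ∑ i ∈ U, (α * Real.log (marginal μ i) + α) =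
        - ((∑ i ∈ U, (- Real.log (marginal μ i) - 1)) * α) := by
      rw [Finset.sum_mul, ← Finset.sum_neg_distrib]
      exact Finset.sum_congr rfl fun i _ => by ring
    rw [h4]; linarith
  calc P = Real.exp (Real.log P) := (Real.exp_log hpos).symm
    _ ≤ Real.exp (∑ i ∈ U, (α * Real.log (marginal μ i) + α)) := Real.exp_le_exp.2 key
    _ = ∏ i ∈ U, Real.exp (α * Real.log (marginal μ i) + α) := Real.exp_sum _ _
    _ ≤ _ := by
      refine Finset.prod_le_prod (fun i _ => (Real.exp_pos _).le) fun i hi => ?_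
      rw [Real.exp_add, mul_comm, Real.rpow_def_of_pos (hm i hi), mul_comm α]
      gcongr

/-! ### Moments of counts of independent draws -/

/-- The expectation of `g l`, where `l` is a list of `t` independent draws from `[n]` with
probabilities `q`. -/
def drawExp (q : Fin n → ℝ) : ℕ → (List (Fin n) → ℝ) → ℝ
  | 0, g => g []
  | t + 1, g => ∑ i, q i * drawExp q t fun l => g (i :: l)

section drawExp

variable {q : Fin n → ℝ}

theorem drawExp_add (t : ℕ) (f g : List (Fin n) → ℝ) :
    drawExp q t (fun l => f l + g l) = drawExp q t f + drawExp q t g := by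
  induction t generalizing f g with
  | zero => rfl
  | succ t ih => simp only [drawExp, ih, mul_add, Finset.sum_add_distrib]

theorem drawExp_const_mul (t : ℕ) (c : ℝ) (f : List (Fin n) → ℝ) :
    drawExp q t (fun l => c * f l) = c * drawExp q t f := by
  induction t generalizing f with
  | zero => rfl
  | succ t ih =>
    simp only [drawExp, ih, Finset.mul_sum]
    exact Finset.sum_congr rfl fun i _ => by ring

theorem drawExp_sub (t : ℕ) (f g : List (Fin n) → ℝ) :
    drawExp q t (fun l => f l - g l) = drawExp q t f - drawExp q t g := by
  have h : ∀ l, f l - g l = f l + (-1) * g l := fun l => by ring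
  simp only [h]
  rw [drawExp_add, drawExp_const_mul]
  ring

theorem drawExp_zero_fun (t : ℕ) : drawExp q t (fun _ => 0) = 0 := by
  simpa using drawExp_const_mul (q := q) t 0 (fun _ => 0)

theorem drawExp_sum {ι : Type*} (t : ℕ) (s : Finset ι) (f : ι → List (Fin n) → ℝ) :
    drawExp q t (fun l => ∑ a ∈ s, f a l) = ∑ a ∈ s, drawExp q t (f a) := by
  classical
  induction s using Finset.induction_on with
  | empty => simp [drawExp_zero_fun]
  | insert a s ha ih => simp only [Finset.sum_insert ha, drawExp_add, ih]

theorem drawExp_mono (hq : ∀ i, 0 ≤ q i) (t : ℕ) {f g : List (Fin n) → ℝ}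
    (h : ∀ l, f l ≤ g l) : drawExp q t f ≤ drawExp q t g := by
  induction t generalizing f g with
  | zero => exact h []
  | succ t ih =>
    exact Finset.sum_le_sum fun i _ => mul_le_mul_of_nonneg_left (ih fun l => h _) (hq i)

theorem drawExp_const (hq : ∑ i, q i = 1) (t : ℕ) (c : ℝ) : drawExp q t (fun _ => c) = c := by
  induction t with
  | zero => rfl
  | succ t ih => simp only [drawExp, ih, ← Finset.sum_mul, hq, one_mul]

theorem abs_drawExp_le (hq : ∀ i, 0 ≤ q i) (t : ℕ) (f : List (Fin n) → ℝ) :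
    |drawExp q t f| ≤ drawExp q t fun l => |f l| := by
  rw [abs_le]
  constructor
  · have := drawExp_mono hq t fun l => neg_abs_le (f l)
    have h := drawExp_const_mul (q := q) t (-1) fun l => |f l|
    simp only [neg_mul, one_mul] at h
    rwa [h] at this
  · exact drawExp_mono hq t fun l => le_abs_self (f l)

theorem succ_descFactorial_eq_add (N a : ℕ) :
    (N + 1).descFactorial a = N.descFactorial a + a * N.descFactorial (a - 1) := by
  cases a with
  | zero => simp
  | succ a =>
    rw [Nat.succ_descFactorial_succ, Nat.descFactorial_succ, Nat.add_sub_cancel, ← add_mul]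
    rcases le_or_gt a N with h | h
    · congr 1; omega
    · rw [Nat.descFactorial_of_lt h, mul_zero, mul_zero]

theorem prod_descFactorial_count_cons (a : Fin n → ℕ) (i : Fin n) (l : List (Fin n)) :
    ∏ j, (((i :: l).count j).descFactorial (a j) : ℝ) =
      ∏ j, ((l.count j).descFactorial (a j) : ℝ) +
        a i * ∏ j, ((l.count j).descFactorial (Function.update a i (a i - 1) j) : ℝ) := by
  rw [← Finset.mul_prod_erase _ _ (Finset.mem_univ i),
    ← Finset.mul_prod_erase _ (fun j => ((l.count j).descFactorial (a j) : ℝ)) (Finset.mem_univ i),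
    ← Finset.mul_prod_erase _ (fun j => ((l.count j).descFactorial
      (Function.update a i (a i - 1) j) : ℝ)) (Finset.mem_univ i)]
  have h1 : ∏ j ∈ Finset.univ.erase i, (((i :: l).count j).descFactorial (a j) : ℝ) =
      ∏ j ∈ Finset.univ.erase i, ((l.count j).descFactorial (a j) : ℝ) :=
    Finset.prod_congr rfl fun j hj => by
      rw [List.count_cons_of_ne (Finset.ne_of_mem_erase hj).symm]
  have h2 : ∏ j ∈ Finset.univ.erase i, ((l.count j).descFactorial
      (Function.update a i (a i - 1) j) : ℝ) =
      ∏ j ∈ Finset.univ.erase i, ((l.count j).descFactorial (a j) : ℝ) :=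
    Finset.prod_congr rfl fun j hj => by
      rw [Function.update_of_ne (Finset.ne_of_mem_erase hj)]
  rw [h1, h2, List.count_cons_self, succ_descFactorial_eq_add, Function.update_self]
  push_cast
  ring

/-- Joint factorial moments of the multinomial distribution. -/
theorem drawExp_prod_descFactorial (hq : ∑ i, q i = 1) (t : ℕ) (a : Fin n → ℕ) :
    drawExp q t (fun l => ∏ j, ((l.count j).descFactorial (a j) : ℝ)) =
      t.descFactorial (∑ j, a j) * ∏ j, q j ^ a j := by
  induction t generalizing a with
  | zero =>
    simp only [drawExp, List.count_nil]
    by_cases h : ∃ i, a i ≠ 0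
    · obtain ⟨i, hi⟩ := h
      rw [Finset.prod_eq_zero (Finset.mem_univ i), Nat.descFactorial_of_lt]
      · simp
      · exact (Nat.pos_of_ne_zero hi).trans_le
          (Finset.single_le_sum (fun _ _ => Nat.zero_le _) (Finset.mem_univ i))
      · rw [Nat.descFactorial_of_lt (Nat.pos_of_ne_zero hi), Nat.cast_zero]
    · push Not at h
      simp [h]
  | succ t ih =>
    simp only [drawExp, prod_descFactorial_count_cons, drawExp_add, drawExp_const_mul, ih]
    have hterm : ∀ i, q i * (t.descFactorial (∑ j, a j) * ∏ j, q j ^ a j +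
        a i * (t.descFactorial (∑ j, Function.update a i (a i - 1) j) *
          ∏ j, q j ^ Function.update a i (a i - 1) j)) =
        q i * (t.descFactorial (∑ j, a j) * ∏ j, q j ^ a j) +
          a i * (t.descFactorial (∑ j, a j - 1) * ∏ j, q j ^ a j) := by
      intro i
      rw [mul_add]
      congr 1
      rcases Nat.eq_zero_or_pos (a i) with h0 | h0
      · simp [h0]
      have hs : ∑ j, Function.update a i (a i - 1) j = ∑ j, a j - 1 := by
        rw [Finset.sum_update_of_mem (Finset.mem_univ i),
          ← Finset.add_sum_erase _ a (Finset.mem_univ i), Finset.sdiff_singleton_eq_erase]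
        omega
      have hp : q i * ∏ j, q j ^ Function.update a i (a i - 1) j = ∏ j, q j ^ a j := by
        rw [← Finset.mul_prod_erase _ _ (Finset.mem_univ i), Function.update_self, ← mul_assoc,
          ← pow_succ', Nat.sub_add_cancel h0, ← Finset.mul_prod_erase _ (fun j => q j ^ a j)
            (Finset.mem_univ i)]
        congr 1
        exact Finset.prod_congr rfl fun j hj => by
          rw [Function.update_of_ne (Finset.ne_of_mem_erase hj)]
      rw [hs, ← hp]
      ring
    simp only [hterm]
    rw [Finset.sum_add_distrib, ← Finset.sum_mul, ← Finset.sum_mul, hq,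
      succ_descFactorial_eq_add]
    push_cast
    ring

theorem drawExp_prod_count (hq : ∑ i, q i = 1) (t : ℕ) (S : Finset (Fin n)) :
    drawExp q t (fun l => ∏ i ∈ S, (l.count i : ℝ)) = t.descFactorial S.card * ∏ i ∈ S, q i := by
  have h := drawExp_prod_descFactorial hq t (fun i => if i ∈ S then 1 else 0)
  have h1 : ∀ l : List (Fin n), ∏ i ∈ S, (l.count i : ℝ) =
      ∏ j, ((l.count j).descFactorial (if j ∈ S then 1 else 0) : ℝ) := by
    intro l
    rw [← Finset.prod_subset (Finset.subset_univ S)]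
    · exact Finset.prod_congr rfl fun i hi => by simp [hi]
    · intro i _ hi; simp [hi]
  simp only [h1, h]
  congr 1
  · simp
  · rw [← Finset.prod_subset (Finset.subset_univ S)]
    · exact Finset.prod_congr rfl fun i hi => by simp [hi]
    · intro i _ hi; simp [hi]

/-- The counts of a multinomial vector are negatively correlated, so that a product of counts and
squares of counts has at most the mean that it would have for independent Poisson counts. -/
theorem drawExp_prod_count_mul_prod_count_le (hq0 : ∀ i, 0 < q i) (hq : ∑ i, q i = 1) {t : ℕ}
    (ht : 0 < t) (S T : Finset (Fin n)) :
    drawExp q t (fun l => (∏ i ∈ S, (l.count i : ℝ)) * ∏ i ∈ T, (l.count i : ℝ)) ≤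
      (∏ i ∈ S, t * q i) * (∏ i ∈ T, t * q i) * ∏ i ∈ S ∩ T, (1 + 1 / (t * q i)) := by
  have ht' : (0 : ℝ) < t := Nat.cast_pos.2 ht
  set a : Fin n → ℕ := fun i => (if i ∈ S then 1 else 0) + (if i ∈ T then 1 else 0) with ha
  have ext : ∀ (A : Finset (Fin n)) (f : Fin n → ℝ), ∏ i ∈ A, f i = ∏ i, if i ∈ A then f i else 1 :=
    fun A f => by rw [Finset.prod_ite_mem, Finset.univ_inter]
  -- `N ^ 2 = N (N - 1) + N` at the elements of `S ∩ T`
  have h1 : ∀ l : List (Fin n), (∏ i ∈ S, (l.count i : ℝ)) * ∏ i ∈ T, (l.count i : ℝ) =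
      ∑ V : Finset (Fin n), (if Vᶜ ⊆ S ∩ T then 1 else 0) *
        ∏ j, ((l.count j).descFactorial (if j ∈ V then a j else 1) : ℝ) := by
    intro l
    have h2 : (∏ i ∈ S, (l.count i : ℝ)) * ∏ i ∈ T, (l.count i : ℝ) =
        ∏ i, (((l.count i).descFactorial (a i) : ℝ) +
          (if i ∈ S ∩ T then 1 else 0) * l.count i) := by
      rw [ext S, ext T, ← Finset.prod_mul_distrib]
      refine Finset.prod_congr rfl fun i _ => ?_
      by_cases hS : i ∈ S <;> by_cases hT : i ∈ T <;> simp [ha, hS, hT]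
      rcases Nat.eq_zero_or_pos (l.count i) with h0 | h0
      · simp [h0]
      · push_cast [Nat.cast_sub (show 1 ≤ l.count i from h0)]
        ring
    rw [h2, Finset.prod_add, Finset.powerset_univ]
    refine Finset.sum_congr rfl fun V _ => ?_
    rw [← Finset.compl_eq_univ_sdiff, Finset.prod_mul_distrib,
      ← Finset.prod_mul_prod_compl V (fun j => ((l.count j).descFactorial
        (if j ∈ V then a j else 1) : ℝ))]
    have h3 : ∏ i ∈ Vᶜ, (if i ∈ S ∩ T then (1 : ℝ) else 0) =
        if Vᶜ ⊆ S ∩ T then 1 else 0 := by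
      rw [Finset.prod_ite_zero]
      simp [Finset.subset_iff]
    rw [h3, mul_left_comm]
    congr 2
    · exact Finset.prod_congr rfl fun i hi => by rw [if_pos hi]
    · exact Finset.prod_congr rfl fun i hi => by
        rw [if_neg (Finset.mem_compl.1 hi), Nat.descFactorial_one]
  simp only [h1, drawExp_sum, drawExp_const_mul, drawExp_prod_descFactorial hq]
  have h4 : (∏ i ∈ S, t * q i) * (∏ i ∈ T, t * q i) * ∏ i ∈ S ∩ T, (1 + 1 / (t * q i)) =
      ∑ V : Finset (Fin n), (if Vᶜ ⊆ S ∩ T then 1 else 0) *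
        ∏ j, (t * q j) ^ (if j ∈ V then a j else 1) := by
    have h2 : (∏ i ∈ S, t * q i) * (∏ i ∈ T, t * q i) * ∏ i ∈ S ∩ T, (1 + 1 / (t * q i)) =
        ∏ i, ((t * q i) ^ a i + (if i ∈ S ∩ T then 1 else 0) * (t * q i)) := by
      rw [ext S, ext T, ext (S ∩ T), ← Finset.prod_mul_distrib, ← Finset.prod_mul_distrib]
      refine Finset.prod_congr rfl fun i _ => ?_
      have := (hq0 i).ne'
      by_cases hS : i ∈ S <;> by_cases hT : i ∈ T <;> simp [ha, hS, hT]
      field_simp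
    rw [h2, Finset.prod_add, Finset.powerset_univ]
    refine Finset.sum_congr rfl fun V _ => ?_
    rw [← Finset.compl_eq_univ_sdiff, Finset.prod_mul_distrib,
      ← Finset.prod_mul_prod_compl V (fun j => (t * q j) ^ (if j ∈ V then a j else 1))]
    have h3 : ∏ i ∈ Vᶜ, (if i ∈ S ∩ T then (1 : ℝ) else 0) =
        if Vᶜ ⊆ S ∩ T then 1 else 0 := by
      rw [Finset.prod_ite_zero]
      simp [Finset.subset_iff]
    rw [h3, mul_left_comm]
    congr 2
    · exact Finset.prod_congr rfl fun i hi => by rw [if_pos hi]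
    · exact Finset.prod_congr rfl fun i hi => by
        rw [if_neg (Finset.mem_compl.1 hi), pow_one]
  rw [h4]
  refine Finset.sum_le_sum fun V _ => mul_le_mul_of_nonneg_left ?_ (by split_ifs <;> simp)
  simp only [mul_pow, Finset.prod_mul_distrib]
  refine mul_le_mul_of_nonneg_right ?_ (Finset.prod_nonneg fun i _ => pow_nonneg (hq0 i).le _)
  rw [Finset.prod_pow_eq_pow_sum]
  exact_mod_cast Nat.descFactorial_le_pow _ _

end drawExp

/-! ### Sampling from a random external field -/

section extField

variable {lam : Fin n → ℝ} {μ : PMF (KSubset n k)}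

/-- The normalizing constant of the external field `lam ⋆ μ`. -/
def partitionFn (lam : Fin n → ℝ) (μ : PMF (KSubset n k)) : ℝ :=
  ∑ S : KSubset n k, (μ S).toReal * ∏ i ∈ S.1, lam i

theorem toReal_fieldWeight (hlam : ∀ i, 0 ≤ lam i) (S : KSubset n k) :
    (fieldWeight lam μ S).toReal = (μ S).toReal * ∏ i ∈ S.1, lam i := by
  rw [fieldWeight, ENNReal.toReal_mul, ENNReal.toReal_prod]
  congr 1
  exact Finset.prod_congr rfl fun i _ => ENNReal.toReal_ofReal (hlam i)

theorem toReal_tsum_fieldWeight (hlam : ∀ i, 0 ≤ lam i) :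
    (∑' S, fieldWeight lam μ S).toReal = partitionFn lam μ := by
  have hne := tsum_fieldWeight_ne_top lam μ
  rw [tsum_fintype] at hne ⊢
  rw [ENNReal.toReal_sum (ENNReal.sum_ne_top.1 hne), partitionFn]
  exact Finset.sum_congr rfl fun S _ => toReal_fieldWeight hlam S

theorem tsum_fieldWeight_eq_zero_iff (hlam : ∀ i, 0 ≤ lam i) :
    ∑' S, fieldWeight lam μ S = 0 ↔ partitionFn lam μ = 0 := by
  rw [← toReal_tsum_fieldWeight hlam, ENNReal.toReal_eq_zero_iff,
    or_iff_left (tsum_fieldWeight_ne_top lam μ)]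

theorem toReal_extField_none (hlam : ∀ i, 0 ≤ lam i) :
    (extField lam μ none).toReal = if partitionFn lam μ = 0 then 1 else 0 := by
  rw [extField]
  by_cases h : ∑' S, fieldWeight lam μ S = 0
  · rw [dif_pos h, if_pos ((tsum_fieldWeight_eq_zero_iff hlam).1 h)]
    simp
  · rw [dif_neg h, if_neg (mt (tsum_fieldWeight_eq_zero_iff hlam).2 h)]
    simp [PMF.map_apply]

theorem map_some_apply {Ω : Type*} (ν : PMF Ω) (ω : Ω) : ν.map some (some ω) = ν ω := by
  classical
  rw [PMF.map_apply, tsum_eq_single ω]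
  · simp
  · intro b hb; simp [hb.symm]

/-- If all weights vanish, both sides are zero, the right-hand one as a quotient by zero. -/
theorem toReal_extField_some (hlam : ∀ i, 0 ≤ lam i) (S : KSubset n k) :
    (extField lam μ (some S)).toReal =
      (μ S).toReal * (∏ i ∈ S.1, lam i) / partitionFn lam μ := by
  rw [extField]
  by_cases h : ∑' S, fieldWeight lam μ S = 0
  · rw [dif_pos h, (tsum_fieldWeight_eq_zero_iff hlam).1 h]
    simp
  · rw [dif_neg h, map_some_apply, PMF.normalize_apply, ENNReal.toReal_mul, ENNReal.toReal_inv,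
      toReal_tsum_fieldWeight hlam, toReal_fieldWeight hlam, div_eq_mul_inv]

/-- The pointwise comparison of the outcome of sampling from `lam ⋆ μ` with the weights normalized
by a constant `m` in place of the normalizing constant of `lam ⋆ μ`. -/
theorem sum_abs_extField_sub (hlam : ∀ i, 0 ≤ lam i) {m : ℝ} (hm : 0 < m) :
    (extField lam μ none).toReal +
      ∑ S : KSubset n k, |(extField lam μ (some S)).toReal -
        (μ S).toReal * (∏ i ∈ S.1, lam i) / m| = |partitionFn lam μ / m - 1| := by
  have hnn : ∀ S : KSubset n k, 0 ≤ (μ S).toReal * ∏ i ∈ S.1, lam i := fun S =>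
    mul_nonneg ENNReal.toReal_nonneg (Finset.prod_nonneg fun i _ => hlam i)
  rw [toReal_extField_none hlam]
  simp only [toReal_extField_some hlam]
  split_ifs with h
  · have h0 : ∀ S : KSubset n k, (μ S).toReal * ∏ i ∈ S.1, lam i = 0 := fun S =>
      (Finset.sum_eq_zero_iff_of_nonneg fun S _ => hnn S).1 h S (Finset.mem_univ S)
    simp [h0, h]
  · have hZ : 0 < partitionFn lam μ :=
      lt_of_le_of_ne (Finset.sum_nonneg fun S _ => hnn S) (Ne.symm h)
    have : ∀ S : KSubset n k, |(μ S).toReal * (∏ i ∈ S.1, lam i) / partitionFn lam μ -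
        (μ S).toReal * (∏ i ∈ S.1, lam i) / m| =
        ((μ S).toReal * ∏ i ∈ S.1, lam i) * |1 / partitionFn lam μ - 1 / m| := by
      intro S
      rw [← abs_of_nonneg (hnn S), ← abs_mul, abs_of_nonneg (hnn S)]
      congr 1
      ring
    simp only [this]
    rw [← Finset.sum_mul, zero_add]
    change partitionFn lam μ * _ = _
    rw [← abs_of_pos hZ, ← abs_mul, abs_of_pos hZ, abs_sub_comm]
    congr 1
    field_simp

end extField

/-- If a random external field has the same expected weight at all sets, then the outcome of
sampling from it deviates from `μ` by no more than its normalizing constant deviates from its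
mean. -/
theorem tvDist_map_some_le {q : Fin n → ℝ} (hq0 : ∀ i, 0 ≤ q i) (t : ℕ)
    {lam : List (Fin n) → Fin n → ℝ} (hlam : ∀ l i, 0 ≤ lam l i) {μ : PMF (KSubset n k)}
    {m : ℝ} (hm : 0 < m) (hmean : ∀ S : KSubset n k, drawExp q t (fun l => ∏ i ∈ S.1, lam l i) = m)
    {R : PMF (Option (KSubset n k))}
    (hR : ∀ o, (R o).toReal = drawExp q t fun l => (extField (lam l) μ o).toReal) :
    tvDist R (μ.map some) ≤ 1 / 2 * drawExp q t fun l => |partitionFn (lam l) μ / m - 1| := by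
  rw [tvDist]
  refine mul_le_mul_of_nonneg_left ?_ (by norm_num)
  simp only [← fun l => sum_abs_extField_sub (μ := μ) (hlam l) hm]
  rw [drawExp_add, drawExp_sum, Fintype.sum_option]
  have hnone : (μ.map some) none = 0 := by simp [PMF.map_apply]
  refine add_le_add ?_ (Finset.sum_le_sum fun S _ => ?_)
  · rw [hnone, ENNReal.toReal_zero, sub_zero, abs_of_nonneg ENNReal.toReal_nonneg, hR]
  · have h1 : (μ S).toReal =
        drawExp q t fun l => (μ S).toReal * (∏ i ∈ S.1, lam l i) / m := by
      have : ∀ l, (μ S).toReal * (∏ i ∈ S.1, lam l i) / m =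
          ((μ S).toReal / m) * ∏ i ∈ S.1, lam l i := fun l => by ring
      simp only [this]
      rw [drawExp_const_mul, hmean, div_mul_cancel₀ _ hm.ne']
    rw [map_some_apply, hR]
    nth_rewrite 1 [h1]
    rw [← drawExp_sub]
    exact abs_drawExp_le hq0 t _

/-- Expanding the product over the subsets of `S ∩ T` reduces its mean over `S ∼ μ` to bounds on
the joint marginals of `μ`, uniformly in `T`. -/
theorem sum_mul_prod_inter_le (μ : PMF (KSubset n k)) {x : ℝ} {y : Fin n → ℝ}
    (h : ∀ U, jointMarginal μ U * ∏ i ∈ U, y i ≤ x ^ U.card) (T : KSubset n k) :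
    ∑ S : KSubset n k, (μ S).toReal * ∏ i ∈ S.1 ∩ T.1, (1 + y i) ≤ (1 + x) ^ k := by
  have h1 : ∀ S : KSubset n k, (μ S).toReal * ∏ i ∈ S.1 ∩ T.1, (1 + y i) =
      ∑ U ∈ T.1.powerset, (if U ⊆ S.1 then (μ S).toReal else 0) * ∏ i ∈ U, y i := by
    intro S
    rw [Finset.prod_one_add, Finset.mul_sum]
    have : (S.1 ∩ T.1).powerset = T.1.powerset.filter fun U => U ⊆ S.1 := by
      ext U; rw [Finset.mem_powerset, Finset.mem_filter, Finset.mem_powerset,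
        Finset.subset_inter_iff, and_comm]
    rw [this, Finset.sum_filter]
    exact Finset.sum_congr rfl fun U _ => by split_ifs <;> simp
  simp only [h1]
  rw [Finset.sum_comm]
  calc ∑ U ∈ T.1.powerset, ∑ S : KSubset n k,
        (if U ⊆ S.1 then (μ S).toReal else 0) * ∏ i ∈ U, y i
      = ∑ U ∈ T.1.powerset, jointMarginal μ U * ∏ i ∈ U, y i :=
        Finset.sum_congr rfl fun U _ => by rw [jointMarginal, Finset.sum_mul]
    _ ≤ ∑ U ∈ T.1.powerset, x ^ U.card := Finset.sum_le_sum fun U _ => h U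
    _ = ∏ i ∈ T.1, (1 + x) := by
        rw [Finset.prod_one_add]
        exact Finset.sum_congr rfl fun U _ => by rw [Finset.prod_const]
    _ = (1 + x) ^ k := by rw [Finset.prod_const, T.2]

theorem pow_mul_one_sub_le_descFactorial {t : ℕ} (ht : 0 < t) (hk : 0 < k) (hkt : k ≤ t) :
    (t : ℝ) ^ k * (1 - k ^ 2 / t) ≤ t.descFactorial k := by
  have ht' : (0 : ℝ) < t := Nat.cast_pos.2 ht
  have hk' : (1 : ℝ) ≤ k := Nat.one_le_cast.2 hk
  have hkt' : (k : ℝ) ≤ t := Nat.cast_le.2 hkt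
  have h1 : ((t : ℝ) + 1 - k) ^ k ≤ t.descFactorial k := by
    have := Nat.pow_sub_le_descFactorial t k
    have h2 : (((t + 1 - k) ^ k : ℕ) : ℝ) ≤ t.descFactorial k := Nat.cast_le.2 this
    rwa [Nat.cast_pow, Nat.cast_sub (by omega), Nat.cast_add, Nat.cast_one] at h2
  have h2 : 1 + (k : ℝ) * (-((k - 1) / t)) ≤ (1 + -((k - 1) / t)) ^ k := by
    refine one_add_mul_le_pow ?_ k
    have : ((k : ℝ) - 1) / t ≤ 1 := (div_le_one ht').2 (by linarith)
    linarith
  calc (t : ℝ) ^ k * (1 - k ^ 2 / t) ≤ t ^ k * (1 + -((k - 1) / t)) ^ k := by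
        refine mul_le_mul_of_nonneg_left (le_trans ?_ h2) (by positivity)
        have : (k : ℝ) ^ 2 / t = k * (k / t) := by ring
        rw [this]
        have : (k : ℝ) * ((k - 1) / t) ≤ k * (k / t) := by gcongr; linarith
        linarith
    _ = ((t : ℝ) + 1 - k) ^ k := by
        rw [← mul_pow]; congr 1; field_simp; ring
    _ ≤ _ := h1

theorem one_add_pow_mul_le_one {x : ℝ} (hx : 0 ≤ x) (hx1 : x ≤ 1) (k : ℕ) :
    (1 + x) ^ k * (1 - k * x) ≤ 1 := by
  have h := one_add_mul_le_pow (show (-2 : ℝ) ≤ -x by linarith) k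
  calc (1 + x) ^ k * (1 - k * x) ≤ (1 + x) ^ k * (1 + -x) ^ k :=
        mul_le_mul_of_nonneg_left (by linarith) (by positivity)
    _ = (1 - x ^ 2) ^ k := by rw [← mul_pow]; congr 1; ring
    _ ≤ 1 := pow_le_one₀ (by nlinarith) (by nlinarith)

/-- The vector of counts in `l`, weighted by `w`. -/
def countField (w : Fin n → ℝ) (l : List (Fin n)) (i : Fin n) : ℝ := l.count i * w i

theorem drawExp_prod_countField {q w : Fin n → ℝ} {h : ℝ} (hq : ∑ i, q i = 1)
    (hw : ∀ i, q i * w i = h) (t : ℕ) (S : KSubset n k) :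
    drawExp q t (fun l => ∏ i ∈ S.1, countField w l i) = t.descFactorial k * h ^ k := by
  have h1 : ∀ l : List (Fin n), ∏ i ∈ S.1, countField w l i =
      (∏ i ∈ S.1, w i) * ∏ i ∈ S.1, (l.count i : ℝ) := fun l => by
    rw [← Finset.prod_mul_distrib]
    exact Finset.prod_congr rfl fun i _ => mul_comm _ _
  simp only [h1]
  rw [drawExp_const_mul, drawExp_prod_count hq, mul_left_comm, mul_comm (∏ i ∈ S.1, w i),
    ← Finset.prod_mul_distrib, S.2]
  simp only [hw]
  rw [Finset.prod_const, S.2]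

theorem drawExp_sq_partitionFn_le {q w : Fin n → ℝ} {h x : ℝ} (hq0 : ∀ i, 0 < q i)
    (hq : ∑ i, q i = 1) (hw : ∀ i, q i * w i = h) (hh : 0 < h) {t : ℕ} (ht : 0 < t)
    {μ : PMF (KSubset n k)}
    (hx : ∀ U, jointMarginal μ U * ∏ i ∈ U, 1 / (t * q i) ≤ x ^ U.card) :
    drawExp q t (fun l => partitionFn (countField w l) μ ^ 2) ≤
      (t ^ k * h ^ k) ^ 2 * (1 + x) ^ k := by
  have hw0 : ∀ i, 0 ≤ w i := fun i =>
    (pos_of_mul_pos_right (by rw [hw i]; exact hh) (hq0 i).le).le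
  have h1 : ∀ l, partitionFn (countField w l) μ ^ 2 =
      ∑ T : KSubset n k, ∑ S : KSubset n k, ((μ T).toReal * (μ S).toReal *
        ((∏ i ∈ S.1, w i) * ∏ i ∈ T.1, w i)) *
        ((∏ i ∈ S.1, (l.count i : ℝ)) * ∏ i ∈ T.1, (l.count i : ℝ)) := by
    intro l
    rw [sq, partitionFn, Finset.sum_mul_sum]
    refine Finset.sum_congr rfl fun T _ => Finset.sum_congr rfl fun S _ => ?_
    simp only [countField, Finset.prod_mul_distrib]
    ring
  simp only [h1, drawExp_sum, drawExp_const_mul]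
  have hpair : ∀ T S : KSubset n k, ((μ T).toReal * (μ S).toReal *
      ((∏ i ∈ S.1, w i) * ∏ i ∈ T.1, w i)) * drawExp q t (fun l =>
        (∏ i ∈ S.1, (l.count i : ℝ)) * ∏ i ∈ T.1, (l.count i : ℝ)) ≤
      (t ^ k * h ^ k) ^ 2 * ((μ T).toReal *
        ((μ S).toReal * ∏ i ∈ S.1 ∩ T.1, (1 + 1 / (t * q i)))) := by
    intro T S
    have hprod : ∀ A : KSubset n k, (∏ i ∈ A.1, w i) * ∏ i ∈ A.1, t * q i = t ^ k * h ^ k := by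
      intro A
      rw [← Finset.prod_mul_distrib, ← mul_pow]
      have : ∀ i, w i * (t * q i) = t * h := fun i => by rw [← hw i]; ring
      simp only [this]
      rw [Finset.prod_const, A.2]
    refine (mul_le_mul_of_nonneg_left
      (drawExp_prod_count_mul_prod_count_le hq0 hq ht S.1 T.1) ?_).trans_eq ?_
    · have := Finset.prod_nonneg fun i (_ : i ∈ S.1) => hw0 i
      have := Finset.prod_nonneg fun i (_ : i ∈ T.1) => hw0 i
      positivity
    · rw [sq]
      nth_rewrite 1 [← hprod S]
      rw [← hprod T]
      ring
  refine (Finset.sum_le_sum fun T _ => Finset.sum_le_sum fun S _ => hpair T S).trans ?_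
  simp only [← Finset.mul_sum]
  refine mul_le_mul_of_nonneg_left ?_ (by positivity)
  calc ∑ T : KSubset n k, (μ T).toReal * ∑ S : KSubset n k,
        (μ S).toReal * ∏ i ∈ S.1 ∩ T.1, (1 + 1 / (t * q i))
      ≤ ∑ T : KSubset n k, (μ T).toReal * (1 + x) ^ k :=
        Finset.sum_le_sum fun T _ => mul_le_mul_of_nonneg_left
          (sum_mul_prod_inter_le μ hx T) ENNReal.toReal_nonneg
    _ = (1 + x) ^ k := by rw [← Finset.sum_mul, sum_toReal_eq_one, one_mul]

/-- With enough draws, the normalizing constant of the random external field is concentrated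
around its mean, which is positive. -/
theorem drawExp_abs_partitionFn_sub_le {q w : Fin n → ℝ} {h x ε : ℝ} (hq0 : ∀ i, 0 < q i)
    (hq : ∑ i, q i = 1) (hw : ∀ i, q i * w i = h) (hh : 0 < h) {t : ℕ} (ht : 0 < t)
    (hk : 0 < k) (hε : 0 < ε) (hε1 : ε < 1) {μ : PMF (KSubset n k)}
    (hx : ∀ U, jointMarginal μ U * ∏ i ∈ U, 1 / (t * q i) ≤ x ^ U.card)
    (hx0 : 0 ≤ x) (hkx : k * x ≤ 6 * (ε ^ 2 / 16)) (hkt : (k : ℝ) ^ 2 / t ≤ ε ^ 2 / 16) :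
    0 < (t.descFactorial k * h ^ k : ℝ) ∧
    drawExp q t (fun l => |partitionFn (countField w l) μ / (t.descFactorial k * h ^ k) - 1|)
      ≤ ε := by
  have ht' : (0 : ℝ) < t := Nat.cast_pos.2 ht
  have hk' : (1 : ℝ) ≤ k := Nat.one_le_cast.2 hk
  set a := ε ^ 2 / 16 with ha
  have ha0 : 0 < a := by positivity
  have ha1 : a ≤ 1 / 16 := by rw [ha]; nlinarith
  have hkt' : k ≤ t := by
    have h1 : (k : ℝ) ^ 2 ≤ t := by
      rw [div_le_iff₀ ht'] at hkt; nlinarith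
    exact_mod_cast (show (k : ℝ) ≤ t by nlinarith)
  set m : ℝ := t.descFactorial k * h ^ k with hm
  have hm_ge : t ^ k * h ^ k * (1 - a) ≤ m := by
    calc t ^ k * h ^ k * (1 - a) ≤ t ^ k * h ^ k * (1 - k ^ 2 / t) :=
          mul_le_mul_of_nonneg_left (by linarith) (by positivity)
      _ = (t ^ k * (1 - k ^ 2 / t)) * h ^ k := by ring
      _ ≤ m := mul_le_mul_of_nonneg_right (pow_mul_one_sub_le_descFactorial ht hk hkt')
          (by positivity)
  have hm0 : 0 < m := lt_of_lt_of_le (mul_pos (by positivity) (by linarith)) hm_ge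
  refine ⟨hm0, ?_⟩
  have hx1 : x ≤ 1 := by nlinarith
  have hsecond : drawExp q t (fun l => partitionFn (countField w l) μ ^ 2) ≤
      m ^ 2 * (1 + ε ^ 2) := by
    refine (drawExp_sq_partitionFn_le hq0 hq hw hh ht hx).trans ?_
    have h1 := one_add_pow_mul_le_one hx0 hx1 k
    have h2 : (1 + x) ^ k * (1 - 6 * a) ≤ 1 :=
      (mul_le_mul_of_nonneg_left (by linarith) (by positivity)).trans h1
    have h3 : (1 + x) ^ k ≤ (1 - a) ^ 2 * (1 + ε ^ 2) := by
      have h4 : ε ^ 2 = 16 * a := by rw [ha]; ring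
      have h5 : 1 ≤ ((1 - a) ^ 2 * (1 + ε ^ 2)) * (1 - 6 * a) := by
        rw [h4]
        have h6 : 1 - 8 * a ≤ (1 - a) ^ 2 * (1 - 6 * a) := by nlinarith [sq_nonneg a]
        have h7 : 1 ≤ (1 - 8 * a) * (1 + 16 * a) := by nlinarith
        nlinarith
      exact le_of_mul_le_mul_right (h2.trans h5) (by linarith)
    calc ((t : ℝ) ^ k * h ^ k) ^ 2 * (1 + x) ^ k
        ≤ (t ^ k * h ^ k) ^ 2 * ((1 - a) ^ 2 * (1 + ε ^ 2)) :=
          mul_le_mul_of_nonneg_left h3 (by positivity)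
      _ = (t ^ k * h ^ k * (1 - a)) ^ 2 * (1 + ε ^ 2) := by ring
      _ ≤ m ^ 2 * (1 + ε ^ 2) := by
          refine mul_le_mul_of_nonneg_right (pow_le_pow_left₀ ?_ hm_ge 2) (by positivity)
          exact mul_nonneg (by positivity) (by linarith)
  have hfirst : drawExp q t (fun l => partitionFn (countField w l) μ) = m := by
    simp only [partitionFn, drawExp_sum, drawExp_const_mul, drawExp_prod_countField hq hw]
    rw [← Finset.sum_mul, sum_toReal_eq_one, one_mul]
  -- Instead of the Cauchy–Schwarz inequality, use `|z| ≤ (z ^ 2 / ε + ε) / 2` pointwise.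
  have hpt : ∀ l, |partitionFn (countField w l) μ / m - 1| ≤
      1 / (2 * ε * m ^ 2) * partitionFn (countField w l) μ ^ 2 +
        ((-1 / (ε * m)) * partitionFn (countField w l) μ + (1 / (2 * ε) + ε / 2)) := by
    intro l
    set Z := partitionFn (countField w l) μ
    have h1 : 1 / (2 * ε * m ^ 2) * Z ^ 2 + ((-1 / (ε * m)) * Z + (1 / (2 * ε) + ε / 2)) =
        ((Z / m - 1) ^ 2 + ε ^ 2) / (2 * ε) := by
      field_simp
      ring
    rw [h1, le_div_iff₀ (by positivity), ← sq_abs (Z / m - 1)]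
    nlinarith [sq_nonneg (|Z / m - 1| - ε)]
  refine (drawExp_mono (fun i => (hq0 i).le) t hpt).trans ?_
  rw [drawExp_add, drawExp_add, drawExp_const_mul, drawExp_const_mul, drawExp_const hq, hfirst]
  calc _ ≤ 1 / (2 * ε * m ^ 2) * (m ^ 2 * (1 + ε ^ 2)) +
        (-1 / (ε * m) * m + (1 / (2 * ε) + ε / 2)) := by gcongr
    _ = ε := by field_simp; ring

/-- By the weighted inequality of arithmetic and geometric means, mixing with the uniform
distribution makes the draw of each `i` likely enough. -/
theorem marginal_rpow_le [NeZero n] [NeZero k] {α c : ℝ} (hα : 0 < α) (hα1 : α ≤ 1) (hc : 0 < c)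
    (hc1 : c ≤ 1) {μ : PMF (KSubset n k)} {p : Fin n → ℝ}
    (hp : ∀ i, c * marginal μ i ≤ p i) (i : Fin n) :
    marginal μ i ^ α ≤ k / c * (n : ℝ) ^ (1 - α) * (p i / k + 1 / n) := by
  have hk : (1 : ℝ) ≤ k := Nat.one_le_cast.2 (Nat.pos_of_ne_zero (NeZero.ne k))
  have hn : (0 : ℝ) < n := Nat.cast_pos.2 (Nat.pos_of_ne_zero (NeZero.ne n))
  have hm := marginal_nonneg μ i
  have hp0 : 0 ≤ p i := (mul_nonneg hc.le hm).trans (hp i)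
  have hA : 0 ≤ p i / k := by positivity
  have hkc : 1 ≤ k / c := (one_le_div hc).2 (hc1.trans hk)
  have h1 : marginal μ i ^ α ≤ (k / c) ^ α * (p i / k) ^ α := by
    rw [← Real.mul_rpow (by positivity) hA]
    refine Real.rpow_le_rpow hm ?_ hα.le
    have : k / c * (p i / k) = p i / c := by field_simp
    rw [this, le_div_iff₀ hc]
    linarith [hp i]
  have h2 : (k / c : ℝ) ^ α ≤ k / c := by
    simpa using Real.rpow_le_rpow_of_exponent_le hkc hα1
  have h3 : (p i / k) ^ α ≤ (n : ℝ) ^ (1 - α) * (p i / k + 1 / n) := by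
    have h4 := Real.geom_mean_le_arith_mean2_weighted hα.le (sub_nonneg.2 hα1) hA
      (show (0 : ℝ) ≤ 1 / n by positivity) (by ring)
    have h5 : (1 / n : ℝ) ^ (1 - α) * (n : ℝ) ^ (1 - α) = 1 := by
      rw [← Real.mul_rpow (by positivity) hn.le, one_div_mul_cancel hn.ne', Real.one_rpow]
    have h6 : α * (p i / k) + (1 - α) * (1 / n) ≤ p i / k + 1 / n := by
      have : (0 : ℝ) < 1 / n := by positivity
      nlinarith
    calc (p i / k) ^ α = (n : ℝ) ^ (1 - α) * ((p i / k) ^ α * (1 / n : ℝ) ^ (1 - α)) := by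
          rw [mul_left_comm, mul_comm ((n : ℝ) ^ (1 - α)), h5, mul_one]
      _ ≤ _ := mul_le_mul_of_nonneg_left (h4.trans h6) (by positivity)
  calc marginal μ i ^ α ≤ (k / c) ^ α * (p i / k) ^ α := h1
    _ ≤ (k / c) * ((n : ℝ) ^ (1 - α) * (p i / k + 1 / n)) :=
      mul_le_mul h2 h3 (by positivity) (by positivity)
    _ = _ := by ring

theorem jointMarginal_mul_prod_le [NeZero n] [NeZero k] {α c : ℝ} (hα : 0 < α) (hα1 : α ≤ 1)
    (hc : 0 < c) (hc1 : c ≤ 1) {μ : PMF (KSubset n k)} (hμ : EntropicallyIndependent α μ)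
    {p : Fin n → ℝ} (hp : ∀ i, c * marginal μ i ≤ p i) {t : ℕ} (ht : 0 < t)
    (U : Finset (Fin n)) :
    jointMarginal μ U * ∏ i ∈ U, 1 / (t * ((p i / k + 1 / n) / 2)) ≤
      (6 * k * (n : ℝ) ^ (1 - α) / (c * t)) ^ U.card := by
  have ht' : (0 : ℝ) < t := Nat.cast_pos.2 ht
  have hn : (0 : ℝ) < n := Nat.cast_pos.2 (Nat.pos_of_ne_zero (NeZero.ne n))
  have hq : ∀ i, 0 < p i / k + 1 / n := fun i => by
    have : 0 ≤ p i := (mul_nonneg hc.le (marginal_nonneg μ i)).trans (hp i)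
    positivity
  refine (mul_le_mul_of_nonneg_right (jointMarginal_le_prod hα hα1 hμ U)
    (Finset.prod_nonneg fun i _ => by have := hq i; positivity)).trans ?_
  rw [← Finset.prod_mul_distrib, ← Finset.prod_const]
  refine Finset.prod_le_prod (fun i _ => ?_) fun i _ => ?_
  · have := hq i
    have := marginal_nonneg μ i
    positivity
  · have h1 := marginal_rpow_le hα hα1 hc hc1 hp i
    have h2 := hq i
    have he : Real.exp 1 ≤ 3 := Real.exp_one_lt_three.le
    calc Real.exp 1 * marginal μ i ^ α * (1 / (t * ((p i / k + 1 / n) / 2)))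
        ≤ 3 * (k / c * (n : ℝ) ^ (1 - α) * (p i / k + 1 / n)) *
          (1 / (t * ((p i / k + 1 / n) / 2))) := by
          refine mul_le_mul_of_nonneg_right (mul_le_mul he h1 ?_ (by norm_num)) (by positivity)
          exact Real.rpow_nonneg (marginal_nonneg _ _) _
      _ = _ := by
          generalize p i / k + 1 / n = B at h2
          field_simp
          ring

/-! ### The program and the law of its output -/

/-- The law of a list of `t` independent draws from `Q`. -/
def iid (Q : PMF (Fin n)) : ℕ → PMF (List (Fin n))
  | 0 => PMF.pure []
  | t + 1 => Q.bind fun i => (iid Q t).map (i :: ·)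

theorem length_of_mem_support_iid {Q : PMF (Fin n)} {t : ℕ} {l : List (Fin n)}
    (h : l ∈ (iid Q t).support) : l.length = t := by
  induction t generalizing l with
  | zero => simp [iid] at h; simp [h]
  | succ t ih =>
    simp only [iid, PMF.mem_support_bind_iff, PMF.mem_support_map_iff] at h
    obtain ⟨i, -, l', hl', rfl⟩ := h
    simp [ih hl']

/-- `drawExp` is the expectation with respect to `iid`. -/
theorem toReal_iid_bind {β : Type*} (Q : PMF (Fin n)) (t : ℕ) (G : List (Fin n) → PMF β) (b : β) :
    (((iid Q t).bind G) b).toReal =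
      drawExp (fun i => (Q i).toReal) t fun l => (G l b).toReal := by
  induction t generalizing G with
  | zero => simp [iid, drawExp]
  | succ t ih =>
    rw [iid, PMF.bind_bind, PMF.bind_apply, tsum_fintype, ENNReal.toReal_sum]
    · simp only [drawExp, ENNReal.toReal_mul]
      refine Finset.sum_congr rfl fun i _ => ?_
      rw [PMF.bind_map, ih]
      rfl
    · intro i _
      exact ENNReal.mul_ne_top (PMF.apply_ne_top _ _) (PMF.apply_ne_top _ _)

/-- With probability one half a draw from `D`, otherwise a uniformly random element. -/
def mixWithUniform [NeZero n] (D : PMF (Fin n)) : PMF (Fin n) :=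
  (PMF.uniformOfFintype Bool).bind fun b => if b then D else PMF.uniformOfFintype (Fin n)

theorem toReal_mixWithUniform [NeZero n] (D : PMF (Fin n)) (i : Fin n) :
    (mixWithUniform D i).toReal = ((D i).toReal + 1 / n) / 2 := by
  rw [mixWithUniform, PMF.bind_apply, tsum_fintype, ENNReal.toReal_sum]
  · simp [PMF.uniformOfFintype_apply]
    ring
  · intro i _
    exact ENNReal.mul_ne_top (PMF.apply_ne_top _ _) (PMF.apply_ne_top _ _)

/-- The sparsification program. Its first part computes the number `16 k² n^(1-α) / (c ε²)` in
register `6`, and `1 / n` in register `7`. The loop, counted by register `8`, draws an element `i`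
from the mixture of the sampling oracle and the uniform distribution and appends `i` to the output
with weight `1 / (p i / k + 1 / n)`. The instruction after the call of the sampling oracle makes
both branches of the draw take the same time. -/
def sparsifier : Program :=
  [.const 5 1, .sub 6 5 2, .pow 6 0 6, .mul 6 6 1, .mul 6 6 1, .div 6 6 3, .div 6 6 4, .div 6 6 4,
    .const 7 16, .mul 6 6 7, .div 7 5 0,
    .coin 10, .jumpLT 9 10 15, .uniform 0, .jumpLT 9 5 17, .sample 0, .const 10 0,
    .estimate 11 0, .div 11 11 1, .add 11 11 7, .div 11 5 11, .emit 0 11, .add 8 8 5,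
    .jumpLT 8 6 11]

/-- The state of `sparsifier` after `j` rounds of its loop, if `X` is the bound on their number. -/
structure LoopInv (k : ℕ) (X : ℝ) (j : ℕ) (s : Config n) : Prop where
  pc : s.pc = if (j : ℝ) < X then 11 else 24
  reg1 : s.reg 1 = k
  reg5 : s.reg 5 = 1
  reg6 : s.reg 6 = X
  reg7 : s.reg 7 = 1 / n
  reg8 : s.reg 8 = j
  reg9 : s.reg 9 = 0

/-- The state of `sparsifier` after a round of its loop that draws `i`. -/
def afterRound (p : Fin n → ℝ) (s : Config n) (i : Fin n) : Config n where
  pc := if s.reg 8 + s.reg 5 < s.reg 6 then 11 else 24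
  reg := Function.update (Function.update (Function.update s.reg 10 0) 11
    (s.reg 5 / (p i / s.reg 1 + s.reg 7))) 8 (s.reg 8 + s.reg 5)
  idx := Function.update s.idx 0 i
  out := s.out ++ [(i, s.reg 5 / (p i / s.reg 1 + s.reg 7))]

theorem run_add [NeZero n] (P : Program) (p : Fin n → ℝ) (D : PMF (Fin n)) (m m' : ℕ)
    (s : Config n) : run P p D (m + m') s = (run P p D m s).bind (run P p D m') := by
  induction m generalizing s with
  | zero => simp [run]
  | succ m ih =>
    rw [Nat.succ_add, run, run, PMF.bind_bind]
    congr 1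
    funext s'
    exact ih s'

/-- Both branches of the draw leave `0` in register `10`, so the state after a round depends on the
coin only through the element drawn. -/
theorem run_round [NeZero n] (p : Fin n → ℝ) (D : PMF (Fin n)) {X : ℝ} {j : ℕ} {s : Config n}
    (hs : LoopInv k X j s) (hj : (j : ℝ) < X) :
    run sparsifier p D 11 s = (mixWithUniform D).map (afterRound p s) := by
  obtain ⟨pc, reg, idx, out⟩ := s
  have hpc : pc = 11 := by simpa [hj] using hs.pc
  have h5 : reg 5 = 1 := hs.reg5
  have h9 : reg 9 = 0 := hs.reg9
  subst hpc
  rw [mixWithUniform, PMF.map_bind]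
  simp only [run, step, sparsifier, exec, List.getElem?_cons_succ, List.getElem?_cons_zero,
    Config.setReg, Config.setIdx, PMF.bind_map, Nat.reduceAdd]
  congr 1
  funext b
  cases b <;>
    simp [h5, h9, Function.comp_def, Function.update, PMF.map, afterRound]

theorem afterRound_loopInv (p : Fin n → ℝ) {X : ℝ} {j : ℕ} {s : Config n}
    (hs : LoopInv k X j s) (i : Fin n) : LoopInv k X (j + 1) (afterRound p s i) := by
  obtain ⟨-, h1, h5, h6, h7, h8, h9⟩ := hs
  constructor <;> simp [afterRound, Function.update, *]

/-- The instruction counter and the output at the end of the loop, from any state in which `r`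
rounds are left. All runs take the same time, and a halted program has counter `24`. -/
theorem run_loop [NeZero n] (p : Fin n → ℝ) (D : PMF (Fin n)) {X : ℝ} {r j : ℕ} {s : Config n}
    (hs : LoopInv k X j s) (hr : ⌈X⌉₊ = j + r) :
    (run sparsifier p D (11 * r) s).map (fun s => (s.pc, s.out)) =
      (iid (mixWithUniform D) r).map
        fun l => (24, s.out ++ l.map fun i => (i, 1 / (p i / k + 1 / n))) := by
  induction r generalizing s j with
  | zero =>
    have : ¬ (j : ℝ) < X := by
      rw [not_lt]
      exact Nat.ceil_le.1 (by omega)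
    simp [run, iid, PMF.pure_map, hs.pc, this]
  | succ r ih =>
    have hj : (j : ℝ) < X := Nat.lt_ceil.1 (by omega)
    rw [Nat.mul_succ, Nat.add_comm, run_add, run_round p D hs hj, iid, PMF.map_bind, PMF.map_bind,
      PMF.bind_map]
    congr 1
    funext i
    rw [Function.comp_apply, ih (afterRound_loopInv p hs i) (by omega), PMF.map_comp]
    congr 1
    funext l
    simp [afterRound, hs.reg1, hs.reg5, hs.reg7]

theorem run_setup [NeZero n] (p : Fin n → ℝ) (D : PMF (Fin n)) {α c ε X : ℝ}
    (hX : X = 16 * k ^ 2 * (n : ℝ) ^ (1 - α) / (c * ε ^ 2)) (hX0 : 0 < X) :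
    ∃ s : Config n, run sparsifier p D 11 (init n [(n : ℝ), (k : ℝ), α, c, ε]) = PMF.pure s ∧
      LoopInv k X 0 s ∧ s.out = [] := by
  simp only [run, step, sparsifier, exec, List.getElem?_cons_succ, List.getElem?_cons_zero,
    Config.setReg, Config.setIdx, PMF.pure_bind, Nat.reduceAdd, init]
  refine ⟨_, rfl, ?_, rfl⟩
  constructor <;> simp [Function.update, hX0]
  rw [hX]
  ring

/-! ### Running time and error of the program -/

/-- The vector represented by an output list. -/
def outField (o : List (Fin n × ℝ)) (i : Fin n) : ℝ :=
  (o.map fun e => if e.1 = i then e.2 else 0).sum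

theorem outField_map (w : Fin n → ℝ) (l : List (Fin n)) :
    outField (l.map fun i => (i, w i)) = countField w l := by
  funext i
  induction l with
  | nil => simp [outField, countField]
  | cons j l ih =>
    simp only [outField, countField, List.map_cons, List.sum_cons] at ih ⊢
    rw [ih, List.count_cons]
    by_cases h : j = i
    · simp [h]; ring
    · simp [h]

theorem ncard_countField_ne_zero_le (w : Fin n → ℝ) (l : List (Fin n)) :
    {i | countField w l i ≠ 0}.ncard ≤ l.length := by
  calc {i | countField w l i ≠ 0}.ncard ≤ (l.toFinset : Set (Fin n)).ncard := by
        refine Set.ncard_le_ncard (fun i hi => ?_) (Finset.finite_toSet _)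
        by_contra hn
        refine hi ?_
        rw [Finset.mem_coe, List.mem_toFinset] at hn
        simp [countField, List.count_eq_zero.2 hn]
    _ ≤ l.length := by rw [Set.ncard_coe_finset]; exact List.toFinset_card_le l

end DomainSparsification

end

open DomainSparsification in
theorem theorem1 :
    ∃ (P : DomainSparsification.Program) (A d : ℕ),
      ∀ (n k : ℕ) [NeZero n] [NeZero k] (α c ε : ℝ), 0 < α → α ≤ 1 → 0 < c → 0 < ε → ε < 1 →
      ∀ (μ : PMF (DomainSparsification.KSubset n k)) (p : Fin n → ℝ) (D : PMF (Fin n)),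
        DomainSparsification.EntropicallyIndependent α μ →
        ∑ i, p i = k →
        (∀ i, c * DomainSparsification.marginal μ i ≤ p i) →
        (∀ i, (D i).toReal = p i / k) →
        ∃ T : ℕ,
          (T : ℝ) ≤ A * (k / (c * ε)) ^ d * (n : ℝ) ^ (1 - α) ∧
          (∀ s ∈ (DomainSparsification.run P p D T
              (DomainSparsification.init n [(n : ℝ), (k : ℝ), α, c, ε])).support,
            DomainSparsification.Halted P s ∧
            (∀ i, 0 ≤ s.field i) ∧
            ({i | s.field i ≠ 0}.ncard : ℝ) ≤ A * (k / (c * ε)) ^ d * (n : ℝ) ^ (1 - α)) ∧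
          DomainSparsification.tvDist
            ((DomainSparsification.run P p D T
              (DomainSparsification.init n [(n : ℝ), (k : ℝ), α, c, ε])).bind
                fun s => DomainSparsification.extField s.field μ)
            (μ.map some) ≤ ε := by
  refine ⟨sparsifier, 198, 2, ?_⟩
  intro n k _ _ α c ε hα hα1 hc hε hε1 μ p D hμ hpsum hp hD
  have hk1 : (1 : ℝ) ≤ k := Nat.one_le_cast.2 (Nat.pos_of_ne_zero (NeZero.ne k))
  have hn1 : (1 : ℝ) ≤ n := Nat.one_le_cast.2 (Nat.pos_of_ne_zero (NeZero.ne n))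
  have hk : (0 : ℝ) < k := by linarith
  have hn : (0 : ℝ) < n := by linarith
  -- The estimates and the marginals have the same sum `k`.
  have hc1 : c ≤ 1 := by
    have h := Finset.sum_le_sum fun i (_ : i ∈ Finset.univ) => hp i
    rw [← Finset.mul_sum, sum_marginal, hpsum] at h
    exact le_of_mul_le_mul_right (by linarith) hk
  have hN : 1 ≤ (n : ℝ) ^ (1 - α) := Real.one_le_rpow hn1 (by linarith)
  set N := (n : ℝ) ^ (1 - α) with hN_def
  set X : ℝ := 16 * k ^ 2 * N / (c * ε ^ 2) with hX
  have hX0 : 0 < X := by positivity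
  set t := ⌈X⌉₊ with ht_def
  have ht : 0 < t := Nat.ceil_pos.2 hX0
  have ht' : (0 : ℝ) < t := Nat.cast_pos.2 ht
  have hXt : X ≤ t := Nat.le_ceil X
  -- The setup and each of the `t` rounds take `11` steps. Since `1 ≤ (k / (c ε))² N`, the bound
  -- `11 + 11 t ≤ 22 + 11 X` gives the constant `22 + 11 * 16 = 198`.
  have hT : ((11 + 11 * t : ℕ) : ℝ) ≤ (198 : ℕ) * (k / (c * ε)) ^ 2 * N := by
    have h1 : (t : ℝ) < X + 1 := Nat.ceil_lt_add_one hX0.le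
    have hY : 1 ≤ (k / (c * ε)) ^ 2 * N := by
      have : 1 ≤ k / (c * ε) := by
        rw [one_le_div (by positivity)]; nlinarith
      nlinarith [one_le_pow₀ this (n := 2)]
    have hXY : X ≤ 16 * ((k / (c * ε)) ^ 2 * N) := by
      have h2 : 16 * ((k / (c * ε)) ^ 2 * N) = 16 * k ^ 2 * N / (c ^ 2 * ε ^ 2) := by
        field_simp
      rw [h2, hX]
      gcongr
      nlinarith
    push_cast
    linarith
  set w : Fin n → ℝ := fun i => 1 / (p i / k + 1 / n) with hw_def
  have hB : ∀ i, 0 < p i / k + 1 / n := fun i => by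
    have : 0 ≤ p i := (mul_nonneg hc.le (marginal_nonneg μ i)).trans (hp i)
    positivity
  have hw0 : ∀ i, 0 ≤ w i := fun i => (one_div_pos.2 (hB i)).le
  have hlam : ∀ l i, 0 ≤ countField w l i := fun l i => mul_nonneg (Nat.cast_nonneg _) (hw0 i)
  set L := run sparsifier p D (11 + 11 * t) (init n [(n : ℝ), (k : ℝ), α, c, ε]) with hL
  have hlaw : L.map (fun s => (s.pc, s.out)) =
      (iid (mixWithUniform D) t).map fun l => (24, l.map fun i => (i, w i)) := by
    obtain ⟨s, hs, hinv, hout⟩ := run_setup p D (α := α) (c := c) (ε := ε) hX hX0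
    have h := run_loop p D hinv (r := t) (by simp [ht_def])
    rw [hL, run_add, hs, PMF.pure_bind, h, hout]
    simp [hw_def]
  refine ⟨11 + 11 * t, hT, ?_, ?_⟩
  · intro s hs
    have hmem : (s.pc, s.out) ∈ (L.map fun s => (s.pc, s.out)).support :=
      (PMF.mem_support_map_iff _ _ _).2 ⟨s, hs, rfl⟩
    rw [hlaw, PMF.mem_support_map_iff] at hmem
    obtain ⟨l, hl, hls⟩ := hmem
    obtain ⟨hpc, hout⟩ := Prod.mk.inj hls
    have hfield : s.field = countField w l := by
      rw [← outField_map, hout]; rfl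
    rw [hfield]
    refine ⟨?_, hlam l, le_trans ?_ hT⟩
    · rw [Halted, ← hpc]; simp [sparsifier]
    · have h1 := ncard_countField_ne_zero_le w l
      rw [length_of_mem_support_iid hl] at h1
      exact_mod_cast h1.trans (by omega)
  · have hR : L.bind (fun s => extField s.field μ) =
        (iid (mixWithUniform D) t).bind fun l => extField (countField w l) μ := by
      have h1 : L.bind (fun s => extField s.field μ) =
          (L.map fun s => (s.pc, s.out)).bind fun o => extField (outField o.2) μ := by
        rw [PMF.bind_map]; rfl
      rw [h1, hlaw, PMF.bind_map]
      congr 1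
      funext l
      rw [Function.comp_apply, outField_map]
    have hq : ∀ i, (mixWithUniform D i).toReal = (p i / k + 1 / n) / 2 := fun i => by
      rw [toReal_mixWithUniform, hD]
    have hqw : ∀ i, (mixWithUniform D i).toReal * w i = 1 / 2 := fun i => by
      have h := (hB i).ne'
      rw [hq]
      simp only [hw_def]
      generalize p i / k + 1 / n = B at h
      field_simp
    have hx0 : 0 ≤ 6 * k * N / (c * t) := by positivity
    have hcX : c * X = 16 * k ^ 2 * N / ε ^ 2 := by rw [hX]; field_simp
    have hkx : k * (6 * k * N / (c * t)) ≤ 6 * (ε ^ 2 / 16) := by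
      calc k * (6 * k * N / (c * t)) ≤ k * (6 * k * N / (c * X)) := by gcongr
        _ = 6 * (ε ^ 2 / 16) := by rw [hcX]; field_simp
    have hkt : (k : ℝ) ^ 2 / t ≤ ε ^ 2 / 16 := by
      calc (k : ℝ) ^ 2 / t ≤ k ^ 2 / X := by gcongr
        _ = (ε ^ 2 / 16) * (c / N) := by rw [hX]; field_simp
        _ ≤ ε ^ 2 / 16 := mul_le_of_le_one_right (by positivity)
            ((div_le_one (by linarith)).2 (hc1.trans hN))
    obtain ⟨hm, hdev⟩ := drawExp_abs_partitionFn_sub_le (w := w) (h := 1 / 2) (μ := μ)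
      (q := fun i => (mixWithUniform D i).toReal)
      (fun i => by simp only [hq]; exact half_pos (hB i)) (sum_toReal_eq_one _)
      hqw (by norm_num) ht (Nat.pos_of_ne_zero (NeZero.ne k)) hε hε1
      (fun U => by
        simp only [hq]
        exact jointMarginal_mul_prod_le hα hα1 hc hc1 hμ hp ht U) hx0 hkx hkt
    refine (tvDist_map_some_le (q := fun i => (mixWithUniform D i).toReal)
      (fun i => ENNReal.toReal_nonneg) t hlam hm (fun S => ?_) (fun o => ?_)).trans ?_
    · exact drawExp_prod_countField (sum_toReal_eq_one _) hqw t S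
    · rw [hR]
      exact toReal_iid_bind _ _ _ _
    · linarith
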